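/- Let $(K,\mathcal F)$ be a measurable space, and let $\mu$ be the law on $\Omega=K^{\mathbb Z}$, with the product sigma-algebra $\mathcal F^{\otimes\mathbb Z}$, of a stationary process $X=(X_n)_{n\in\mathbb Z}$ with values in $K$; that is, $\mu$ is a probability measure that is invariant under the shift $(S\omega)_n=\omega_{n+1}$. Let $H$ be the group of all permutations of $\mathbb Z$ that fix all but finitely many integers, and for $\sigma\in H$ let $T_\sigma:\Omega\to\Omega$, $(T_\sigma\omega)_n=\omega_{\sigma(n)}$. Consider the following properties. 1. $X$ is exchangeable: $\mu\circ T_\sigma^{-1}=\mu$ for all $\sigma\in H$. 2. $X$ is quasi-exchangeable with uniformly integrable densities: $\mu\circ T_\sigma^{-1}$ and $\mu$ are equivalent (mutually absolutely continuous) for all $\sigma\in H$, and the family $\left\{\frac{d\mu\circ T_\sigma^{-1}}{d\mu}:\sigma\in H\right\}$ of Radon–Nikodym derivatives is uniformly integrable with respect to $\mu$. 3. $X$ is a mixture of Bernoulli processes: there is a probability measure $\beta$ on the set $M_1(K)$ of all probability measures on $(K,\mathcal F)$, with the sigma-algebra generated by the maps $\pi\mapsto\pi(B)$, $B\in\mathcal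 F$, such that $\mu(A)=\int_{M_1(K)}\pi^{\otimes\mathbb Z}(A)\,d\beta(\pi)$ for all $A\in\mathcal F^{\otimes\mathbb Z}$. If $K$ is a Polish space with its Borel sigma-algebra, or a locally compact Hausdorff space with its Baire sigma-algebra (the one generated by the continuous real functions with compact support), then (1), (2) and (3) are equivalent. Moreover, for every measurable space $(K,\mathcal F)$, (1) and (2) are equivalent, and (3) implies (1). -/

import Mathlib

open MeasureTheory
open scoped ENNReal

noncomputable section

/-- The shift `(S ω)_n = ω_{n+1}` on `K^ℤ`. -/
def shift (K : Type*) (ω : ℤ → K) : ℤ → K := fun n => ω (n + 1)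

/-- The coordinate permutation `(T_σ ω)_n = ω_{σ(n)}` on `K^ℤ`. -/
def permMap (K : Type*) (σ : Equiv.Perm ℤ) (ω : ℤ → K) : ℤ → K := fun n => ω (σ n)

/-- The set `H` of the permutations of `ℤ` that move only finitely many integers. -/
def finitePerms : Set (Equiv.Perm ℤ) := {σ | ∃ N : ℤ, ∀ n : ℤ, N ≤ |n| → σ n = n}

section Laws

variable {K : Type*} [MeasurableSpace K]

/-- The process with law `μ` is stationary: `μ ∘ S⁻¹ = μ`. -/
def IsStationaryLaw (μ : Measure (ℤ → K)) : Prop := μ.map (shift K) = μ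

/-- The process with law `μ` is exchangeable: `μ ∘ T_σ⁻¹ = μ` for all `σ ∈ H`. -/
def IsExchangeableLaw (μ : Measure (ℤ → K)) : Prop :=
  ∀ σ ∈ finitePerms, μ.map (permMap K σ) = μ

/-- The process with law `μ` is quasi-exchangeable: `μ ∘ T_σ⁻¹` and `μ` have the same null sets,
for all `σ ∈ H`. -/
def IsQuasiExchangeableLaw (μ : Measure (ℤ → K)) : Prop :=
  ∀ σ ∈ finitePerms, μ.map (permMap K σ) ≪ μ ∧ μ ≪ μ.map (permMap K σ)

/-- The density `φ_σ = d(μ ∘ T_σ⁻¹)/dμ`, as a real function. -/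
def permDensity (μ : Measure (ℤ → K)) (σ : Equiv.Perm ℤ) (ω : ℤ → K) : ℝ :=
  ((μ.map (permMap K σ)).rnDeriv μ ω).toReal

/-- The process with law `μ` is quasi-exchangeable with uniformly integrable densities. -/
def IsQuasiExchangeableUILaw (μ : Measure (ℤ → K)) : Prop :=
  IsQuasiExchangeableLaw μ ∧
    UniformIntegrable (fun σ : finitePerms => permDensity μ (σ : Equiv.Perm ℤ)) 1 μ

/-- The Bernoulli law `π^{⊗ℤ}` on `K^ℤ`. -/
def bernoulliLaw (p : ProbabilityMeasure K) : Measure (ℤ → K) :=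
  Measure.infinitePi (fun _ : ℤ => (p : Measure K))

/-- The process with law `μ` is a mixture of Bernoulli processes: `μ(A) = ∫ π^{⊗ℤ}(A) dβ(π)` for
all measurable `A`, where `β` is a probability measure on the space of the probability measures
`π` on `K`, with the sigma-algebra that is generated by the evaluations `π ↦ π(B)`. -/
def IsBernoulliMixture (μ : Measure (ℤ → K)) : Prop :=
  ∃ β : Measure (ProbabilityMeasure K), IsProbabilityMeasure β ∧
    ∀ A : Set (ℤ → K), MeasurableSet A → μ A = ∫⁻ p, bernoulliLaw p A ∂β

end Laws

/-- The Baire sigma-algebra of a locally compact Hausdorff space: the smallest one for which all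
continuous real functions with compact support are measurable (equivalently, the one that is
generated by the compact `G_δ` sets). -/
@[reducible] def baireSigmaAlgebra (K : Type*) [TopologicalSpace K] : MeasurableSpace K :=
  ⨆ f : {f : K → ℝ // Continuous f ∧ HasCompactSupport f},
    MeasurableSpace.comap (f : K → ℝ) (borel ℝ)

/-- The measurable space `K` is a locally compact Hausdorff space with its Baire sigma-algebra. -/
def IsLocallyCompactBaireSpace (K : Type*) [m : MeasurableSpace K] : Prop :=
  ∃ t : TopologicalSpace K, T2Space K ∧ LocallyCompactSpace K ∧ m = @baireSigmaAlgebra K t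

end

/-! A product measure does not see a relabelling of its equal factors, so (3) gives (1), and under
(1) every density is 1, so (1) gives (2).

For (2) implies (1), let `σ` be supported in `[-M, M]` and let `A` depend only on this window. Let
`a n` be the average of the indicator of `A` along the first `n` iterates of the shift by `2M+1`; by
the mean ergodic theorem `a n` converges in `L¹`. Let `ρ` act as `σ` in each of the first `n`
blocks. Then `a n ∘ T_ρ` is an average for `T_σ⁻¹ A`, with integral `μ (T_σ⁻¹ A)`, while `a N ∘ T_ρ`
is within `n / N` of `a N`, with integral `μ A`. Since `a n` and `a N` are close off a set of small
`μ`-measure, uniform integrability makes that set small for `μ ∘ T_ρ⁻¹` too, uniformly in `ρ`; hence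
the two measures agree (`measureReal_preimage_eq`).

For (1) implies (3), let `l B` be the asymptotic frequency of visits to `B`. A product of visit
averages over disjoint windows expands into boxes of equal measure, so the integral of `∏ l (B i)`
is the measure of the box (`integral_prod_frequency`). It remains to carry the joint law of all `l
B` over to the space of probability measures. Measurable sets in a product see only countably many
coordinates, so it is enough that any countably many frequencies are almost surely values of one
probability measure. Frequencies are conditional probabilities given the almost invariant events, so
regular conditional distributions provide it: directly on a standard Borel space, and for a Baire
space after mapping to a countable power of `ℝ` and lifting back through the one-point
compactification. -/

section

open Filter Topology
open scoped BoundedContinuousFunction CompactlySupported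

/-! ### Mean ergodic theorem -/

/-- The mean ergodic theorem, in `L¹` form. -/
theorem exists_tendsto_integral_abs_birkhoffAverage_sub {Ω : Type*} [MeasurableSpace Ω]
    {μ : Measure Ω} [IsProbabilityMeasure μ] {T : Ω → Ω} (hT : MeasurePreserving T μ μ)
    {f : Ω → ℝ} (hf : MemLp f 2 μ) :
    ∃ l : Ω → ℝ, Measurable l ∧ Integrable l μ ∧ l ∘ T =ᵐ[μ] l ∧
      Tendsto (fun n : ℕ => ∫ ω, |birkhoffAverage ℝ T f n ω - l ω| ∂μ) atTop (𝓝 0) := by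
  -- Von Neumann's theorem for the Koopman operator: averages converge in `L²` to the projection
  -- onto its fixed vectors. On a probability space this implies `L¹` convergence.
  let U : Lp ℝ 2 μ →L[ℝ] Lp ℝ 2 μ :=
    (Lp.compMeasurePreservingₗᵢ ℝ T hT).toContinuousLinearMap
  have hU : ‖U‖ ≤ 1 := LinearIsometry.norm_toContinuousLinearMap_le _
  have hlim := U.tendsto_birkhoffAverage_orthogonalProjection hU (hf.toLp f)
  set P : U.eqLocus (1 : Lp ℝ 2 μ →L[ℝ] Lp ℝ 2 μ) :=
    (U.eqLocus (1 : Lp ℝ 2 μ →L[ℝ] Lp ℝ 2 μ)).orthogonalProjectionOnto (hf.toLp f) with hP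
  have hPU : Lp.compMeasurePreserving T hT (P : Lp ℝ 2 μ) = P := P.2
  have hPm : MemLp (P : Lp ℝ 2 μ) 2 μ := Lp.memLp _
  have hsum : ∀ n, MemLp (birkhoffSum T f n) 2 μ := fun n =>
    memLp_finsetSum' (Finset.range n) (f := fun k => f ∘ T^[k])
      (fun k _ => hf.comp_measurePreserving (hT.iterate k)) |>.ae_eq
      (by filter_upwards with ω; simp [birkhoffSum])
  have hsumLp : ∀ n, birkhoffSum U id n (hf.toLp f) = (hsum n).toLp _ := by
    intro n
    induction n with
    | zero =>
      simp only [birkhoffSum_zero']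
      exact (MemLp.toLp_zero _).symm
    | succ n ih =>
      have h1 : U^[n] (hf.toLp f) = (hf.comp_measurePreserving (hT.iterate n)).toLp _ := by
        rw [← Lp.toLp_compMeasurePreserving hf (hT.iterate n), ← Lp.compMeasurePreserving_iterate]
        rfl
      rw [birkhoffSum_succ, ih, id, h1, ← MemLp.toLp_add]
      congr 1
      ext ω
      simp [birkhoffSum_succ]
  have havg : ∀ n, MemLp (birkhoffAverage ℝ T f n) 2 μ := fun n => by
    exact (hsum n).const_smul (n : ℝ)⁻¹
  have havgLp : ∀ n, birkhoffAverage ℝ U id n (hf.toLp f) = (havg n).toLp _ := by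
    intro n
    rw [birkhoffAverage, hsumLp, ← MemLp.toLp_const_smul]
    rfl
  refine ⟨(P : Lp ℝ 2 μ), (Lp.stronglyMeasurable _).measurable,
    hPm.integrable one_le_two, ?_, ?_⟩
  · have := Lp.coeFn_compMeasurePreserving (P : Lp ℝ 2 μ) hT
    rw [hPU] at this
    exact this.symm
  · rw [tendsto_iff_norm_sub_tendsto_zero] at hlim
    refine squeeze_zero (fun n => integral_nonneg fun _ => abs_nonneg _) (fun n => ?_) hlim
    have hd : MemLp (birkhoffAverage ℝ T f n - ⇑(P : Lp ℝ 2 μ)) 2 μ := (havg n).sub hPm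
    have h1 : birkhoffAverage ℝ U id n (hf.toLp f) - P = hd.toLp _ := by
      rw [havgLp, MemLp.toLp_sub (havg n) hPm, Lp.toLp_coeFn]
    rw [h1, Lp.norm_toLp]
    have h2 : ∫ ω, |birkhoffAverage ℝ T f n ω - (P : Lp ℝ 2 μ) ω| ∂μ
        = (eLpNorm (birkhoffAverage ℝ T f n - ⇑(P : Lp ℝ 2 μ)) 1 μ).toReal := by
      rw [eLpNorm_one_eq_lintegral_enorm, ← integral_norm_eq_lintegral_enorm hd.1]
      simp
    rw [h2]
    exact ENNReal.toReal_mono hd.2.ne (eLpNorm_le_eLpNorm_of_exponent_le one_le_two hd.1)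

/-! ### Bernoulli laws and the easy implications -/

section

variable {K : Type*} [MeasurableSpace K]

theorem measurable_permMap (σ : Equiv.Perm ℤ) : Measurable (permMap K σ) :=
  measurable_pi_lambda _ fun n => measurable_pi_apply (σ n)

theorem measurable_shift : Measurable (shift K) :=
  measurable_pi_lambda _ fun n => measurable_pi_apply (n + 1)

/-- Finite measures on `K^ℤ` that agree on the measurable boxes are equal. -/
theorem ext_of_boxes {μ ν : Measure (ℤ → K)} [IsFiniteMeasure μ]
    (h : ∀ (s : Finset ℤ) (B : ℤ → Set K), (∀ i, MeasurableSet (B i)) →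
      μ ((s : Set ℤ).pi B) = ν ((s : Set ℤ).pi B)) : μ = ν := by
  refine ext_of_generate_finite _ (generateFrom_squareCylinders (α := fun _ : ℤ => K)).symm
    (isPiSystem_squareCylinders (fun _ => MeasurableSpace.isPiSystem_measurableSet)
      fun _ => MeasurableSet.univ) ?_ ?_
  · rintro _ ⟨s, B, hB, rfl⟩
    exact h s B fun i => hB i (Set.mem_univ i)
  · simpa using h ∅ (fun _ => Set.univ) fun _ => MeasurableSet.univ

theorem measurable_bernoulliLaw : Measurable (bernoulliLaw (K := K)) := by
  have (p : ProbabilityMeasure K) : IsProbabilityMeasure (bernoulliLaw p) := by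
    unfold bernoulliLaw; infer_instance
  refine Measurable.measure_of_isPiSystem_of_isProbabilityMeasure
    (generateFrom_squareCylinders (α := fun _ : ℤ => K)).symm
    (isPiSystem_squareCylinders (fun _ => MeasurableSpace.isPiSystem_measurableSet)
      fun _ => MeasurableSet.univ) ?_
  rintro _ ⟨s, B, hB, rfl⟩
  have hB' : ∀ i, MeasurableSet (B i) := fun i => hB i (Set.mem_univ i)
  simp_rw [bernoulliLaw, Measure.infinitePi_pi (fun _ : ℤ => ((_ : ProbabilityMeasure K) : Measure K))
    (fun i _ => hB' i)]
  exact Finset.measurable_prod _ fun i _ =>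
    (Measure.measurable_coe (hB' i)).comp measurable_subtype_coe

theorem map_permMap_bernoulliLaw (p : ProbabilityMeasure K) (σ : Equiv.Perm ℤ) :
    (bernoulliLaw p).map (permMap K σ) = bernoulliLaw p := by
  refine Measure.eq_infinitePi (fun _ : ℤ => (p : Measure K)) fun s B hB => ?_
  rw [Measure.map_apply (measurable_permMap σ) (MeasurableSet.pi s.countable_toSet fun i _ => hB i)]
  have : permMap K σ ⁻¹' ((s : Set ℤ).pi B)
      = ((s.map σ.toEmbedding : Finset ℤ) : Set ℤ).pi fun i => B (σ.symm i) := by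
    ext ω
    simp only [permMap, Set.mem_preimage, Set.mem_pi, Finset.mem_coe, Finset.mem_map_equiv]
    exact ⟨fun h i hi => by simpa using h _ hi, fun h i hi => by simpa using h (σ i) (by simpa)⟩
  rw [this, bernoulliLaw, Measure.infinitePi_pi _ fun i _ => hB _]
  simp

theorem IsBernoulliMixture.isExchangeableLaw {μ : Measure (ℤ → K)} (h : IsBernoulliMixture μ) :
    IsExchangeableLaw μ := by
  obtain ⟨β, -, hβ⟩ := h
  intro σ _
  ext A hA
  rw [Measure.map_apply (measurable_permMap σ) hA, hβ _ (measurable_permMap σ hA), hβ A hA]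
  refine lintegral_congr fun p => ?_
  rw [← Measure.map_apply (measurable_permMap σ) hA, map_permMap_bernoulliLaw]

theorem IsExchangeableLaw.isQuasiExchangeableUILaw {μ : Measure (ℤ → K)} [IsProbabilityMeasure μ]
    (h : IsExchangeableLaw μ) : IsQuasiExchangeableUILaw μ := by
  refine ⟨fun σ hσ => ?_, ?_⟩
  · rw [h σ hσ]
    exact ⟨Measure.AbsolutelyContinuous.rfl, Measure.AbsolutelyContinuous.rfl⟩
  · refine (uniformIntegrable_const le_rfl ENNReal.one_ne_top
      (memLp_const (1 : ℝ))).ae_eq fun σ => ?_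
    filter_upwards [Measure.rnDeriv_self μ] with ω hω
    rw [permDensity, h σ σ.2, hω, ENNReal.toReal_one]

end

/-! ### Block permutations -/

/-- The permutation that applies `σ` in each of the blocks around `0, m, …, m (n - 1)`. -/
def blockPerm (σ : Equiv.Perm ℤ) (m : ℕ) : ℕ → Equiv.Perm ℤ
  | 0 => 1
  | n + 1 => blockPerm σ m n *
      ((Equiv.addRight ((m : ℤ) * n)).symm.trans (σ.trans (Equiv.addRight ((m : ℤ) * n))))

theorem blockPerm_succ_apply (σ : Equiv.Perm ℤ) (m n : ℕ) (x : ℤ) :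
    blockPerm σ m (n + 1) x = blockPerm σ m n (σ (x - m * n) + m * n) := by
  simp [blockPerm, sub_eq_add_neg]

section

variable {σ : Equiv.Perm ℤ} {M : ℕ}

theorem abs_apply_le_of_abs_le (hσ : ∀ x : ℤ, (M : ℤ) < |x| → σ x = x)
    {x : ℤ} (hx : |x| ≤ M) : |σ x| ≤ M := by
  by_contra! h
  have h1 := σ.injective (hσ _ h)
  rw [h1] at h
  omega

/-- Intervals of radius `M` around distinct multiples of `2M+1` are disjoint, so no translate of `σ`
used so far reaches block `i`. -/
theorem blockPerm_apply_of_le (hσ : ∀ x : ℤ, (M : ℤ) < |x| → σ x = x)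
    {n i : ℕ} (hi : n ≤ i) {k : ℤ} (hk : |k| ≤ M) :
    blockPerm σ (2 * M + 1) n (k + (2 * M + 1 : ℕ) * i) = k + (2 * M + 1 : ℕ) * i := by
  induction n with
  | zero => rfl
  | succ n ih =>
    have h1 : (M : ℤ) < |k + (2 * M + 1 : ℕ) * i - (2 * M + 1 : ℕ) * n| := by
      have : (n : ℤ) + 1 ≤ i := by exact_mod_cast hi
      have h2 : ((2 * M + 1 : ℕ) : ℤ) * 1 ≤ (2 * M + 1 : ℕ) * ((i : ℤ) - n) :=
        mul_le_mul_of_nonneg_left (by linarith) (by positivity)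
      rw [abs_le] at hk
      refine lt_of_lt_of_le ?_ (le_abs_self _)
      push_cast at h2 ⊢
      linarith
    rw [blockPerm_succ_apply, hσ _ h1, sub_add_cancel, ih (by omega)]

theorem blockPerm_apply_of_lt (hσ : ∀ x : ℤ, (M : ℤ) < |x| → σ x = x)
    {n i : ℕ} (hi : i < n) {k : ℤ} (hk : |k| ≤ M) :
    blockPerm σ (2 * M + 1) n (k + (2 * M + 1 : ℕ) * i) = σ k + (2 * M + 1 : ℕ) * i := by
  induction n with
  | zero => omega
  | succ n ih =>
    rw [blockPerm_succ_apply]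
    rcases Nat.lt_succ_iff_lt_or_eq.mp hi with h | rfl
    · have h1 : (M : ℤ) < |k + (2 * M + 1 : ℕ) * i - (2 * M + 1 : ℕ) * n| := by
        have : (i : ℤ) + 1 ≤ n := by exact_mod_cast h
        have h2 : ((2 * M + 1 : ℕ) : ℤ) * 1 ≤ (2 * M + 1 : ℕ) * ((n : ℤ) - i) :=
          mul_le_mul_of_nonneg_left (by linarith) (by positivity)
        rw [abs_le] at hk
        refine lt_of_lt_of_le ?_ (neg_le_abs _)
        push_cast at h2 ⊢
        linarith
      rw [hσ _ h1, sub_add_cancel, ih h]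
    · rw [add_sub_cancel_right, blockPerm_apply_of_le hσ le_rfl (abs_apply_le_of_abs_le hσ hk)]

theorem blockPerm_mem_finitePerms (hσ : ∀ x : ℤ, (M : ℤ) < |x| → σ x = x)
    (m n : ℕ) : blockPerm σ m n ∈ finitePerms := by
  induction n with
  | zero => exact ⟨0, fun _ _ => rfl⟩
  | succ n ih =>
    obtain ⟨N, hN⟩ := ih
    refine ⟨max N (M + 1 + m * n), fun x hx => ?_⟩
    have h1 : (M : ℤ) < |x - m * n| := by
      have h2 : |x| - |(m : ℤ) * n| ≤ |x - m * n| := abs_sub_abs_le_abs_sub _ _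
      rw [abs_of_nonneg (by positivity : (0 : ℤ) ≤ (m : ℤ) * n)] at h2
      have := (le_max_right N _).trans hx
      omega
    rw [blockPerm_succ_apply, hσ _ h1, sub_add_cancel, hN _ ((le_max_left _ _).trans hx)]

end

/-! ### Birkhoff averages along iterates of the shift -/

section

variable {Ω : Type*} {T : Ω → Ω} {f : Ω → ℝ}

theorem birkhoffAverage_mem_Icc (hf : ∀ ω, f ω ∈ Set.Icc (0 : ℝ) 1) (n : ℕ) (ω : Ω) :
    birkhoffAverage ℝ T f n ω ∈ Set.Icc (0 : ℝ) 1 := by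
  have h0 : 0 ≤ ∑ k ∈ Finset.range n, f (T^[k] ω) := Finset.sum_nonneg fun k _ => (hf _).1
  have h1 : ∑ k ∈ Finset.range n, f (T^[k] ω) ≤ n := by
    simpa using Finset.sum_le_card_nsmul (Finset.range n) (fun k => f (T^[k] ω)) 1
      fun k _ => (hf _).2
  simp only [birkhoffAverage, birkhoffSum, smul_eq_mul]
  refine ⟨by positivity, ?_⟩
  rw [inv_mul_eq_div]
  exact div_le_one_of_le₀ h1 n.cast_nonneg

variable [MeasurableSpace Ω] {μ : Measure Ω}

theorem measurable_birkhoffAverage (hT : Measurable T) (hf : Measurable f) (n : ℕ) :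
    Measurable (birkhoffAverage ℝ T f n) := by
  have : Measurable fun ω => (n : ℝ)⁻¹ * ∑ k ∈ Finset.range n, f (T^[k] ω) :=
    (Finset.measurable_sum _ fun k _ => hf.comp (hT.iterate k)).const_mul _
  exact this

theorem integral_birkhoffAverage (hT : MeasurePreserving T μ μ) (hf : Integrable f μ) {n : ℕ}
    (hn : n ≠ 0) : ∫ ω, birkhoffAverage ℝ T f n ω ∂μ = ∫ ω, f ω ∂μ := by
  have h1 (k : ℕ) : ∫ ω, f (T^[k] ω) ∂μ = ∫ ω, f ω ∂μ := by
    have hk := hT.iterate k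
    conv_rhs => rw [← hk.map_eq]
    rw [integral_map hk.measurable.aemeasurable]
    rw [hk.map_eq]
    exact hf.1
  simp only [birkhoffAverage, birkhoffSum, smul_eq_mul]
  have h2 (k : ℕ) : Integrable (fun ω => f (T^[k] ω)) μ :=
    (hT.iterate k).integrable_comp_of_integrable hf
  rw [integral_const_mul, integral_finsetSum _ fun k _ => h2 k]
  simp only [h1, Finset.sum_const, Finset.card_range, nsmul_eq_mul]
  field_simp

end

theorem shift_iterate_apply {K : Type*} (m : ℕ) (ω : ℤ → K) (k : ℤ) : (shift K)^[m] ω k = ω (k + m) := by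
  induction m generalizing ω with
  | zero => simp
  | succ m ih =>
    rw [Function.iterate_succ_apply, ih]
    simp [shift, add_assoc]

theorem shift_iterate_iterate_apply {K : Type*} (m i : ℕ) (ω : ℤ → K) (k : ℤ) :
    ((shift K)^[m])^[i] ω k = ω (k + m * i) := by
  rw [← Function.iterate_mul, shift_iterate_apply]
  push_cast
  rfl

/-! ### Uniform integrability forces exchangeability -/

section

variable {K : Type*} [MeasurableSpace K] {μ : Measure (ℤ → K)}

theorem IsStationaryLaw.measurePreserving (h : IsStationaryLaw μ) :
    MeasurePreserving (shift K) μ μ :=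
  ⟨measurable_shift, h⟩

/-- Uniform integrability bounds exactly this `eLpNorm` on sets of small measure; absolute
continuity turns it into a bound for the permuted law. -/
theorem map_permMap_apply_eq_eLpNorm [IsFiniteMeasure μ] {σ : Equiv.Perm ℤ}
    (h : μ.map (permMap K σ) ≪ μ) {s : Set (ℤ → K)} (hs : MeasurableSet s) :
    μ.map (permMap K σ) s = eLpNorm (s.indicator (permDensity μ σ)) 1 μ := by
  rw [← Measure.setLIntegral_rnDeriv h s, ← lintegral_indicator hs, eLpNorm_one_eq_lintegral_enorm]
  refine lintegral_congr_ae ?_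
  filter_upwards [Measure.rnDeriv_lt_top (μ.map (permMap K σ)) μ] with ω hω
  by_cases hωs : ω ∈ s
  · simp only [hωs, Set.indicator_of_mem, permDensity]
    rw [Real.enorm_of_nonneg ENNReal.toReal_nonneg, ENNReal.ofReal_toReal hω.ne]
  · simp [hωs]

/-- One `ε` bounds `h` off the exceptional set; the other bounds the mass of that set, where `h ≤
1`. -/
theorem integral_comp_le_of_measure_le [IsProbabilityMeasure μ] {σ : Equiv.Perm ℤ}
    {h : (ℤ → K) → ℝ} (hm : Measurable h) (h01 : ∀ ω, h ω ∈ Set.Icc (0 : ℝ) 1) {ε : ℝ}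
    (hε : 0 ≤ ε) (hs : μ.map (permMap K σ) {ω | ε < h ω} ≤ ENNReal.ofReal ε) :
    ∫ ω, h (permMap K σ ω) ∂μ ≤ 2 * ε := by
  have hσ := measurable_permMap (K := K) σ
  have := Measure.isProbabilityMeasure_map (μ := μ) hσ.aemeasurable
  have hms : MeasurableSet {ω | ε < h ω} := measurableSet_lt measurable_const hm
  rw [← integral_map hσ.aemeasurable hm.aestronglyMeasurable]
  calc ∫ ω, h ω ∂(μ.map (permMap K σ))
      ≤ ∫ ω, (ε + {ω | ε < h ω}.indicator (fun _ => (1 : ℝ)) ω) ∂(μ.map (permMap K σ)) := by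
        refine integral_mono ?_ ?_ fun ω => ?_
        · exact Integrable.of_mem_Icc 0 1 hm.aemeasurable (ae_of_all _ h01)
        · exact (integrable_const _).add ((integrable_const _).indicator hms)
        · by_cases hω : ε < h ω
          · simp only [Set.indicator, Set.mem_ofPred_eq, hω, if_true]
            linarith [(h01 ω).2]
          · simp only [Set.indicator, Set.mem_ofPred_eq, hω, if_false]
            linarith
    _ = ε + (μ.map (permMap K σ)).real {ω | ε < h ω} := by
        rw [integral_add (integrable_const _) ((integrable_const _).indicator hms),
          integral_indicator_const _ hms]
        simp
    _ ≤ 2 * ε := by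
        have := ENNReal.toReal_mono ENNReal.ofReal_ne_top hs
        rw [ENNReal.toReal_ofReal hε] at this
        rw [measureReal_def]
        linarith

end

section

variable {K : Type*} [MeasurableSpace K] {μ : Measure (ℤ → K)}

/-- A set that depends only on the coordinates in `[-M, M]`. -/
def DependsOnWindow {K : Type*} (M : ℕ) (A : Set (ℤ → K)) : Prop :=
  ∀ ω ω' : ℤ → K, (∀ k : ℤ, |k| ≤ M → ω k = ω' k) → (ω ∈ A ↔ ω' ∈ A)

theorem indicator_mem_Icc {Ω : Type*} (A : Set Ω) (ω : Ω) :
    A.indicator (fun _ => (1 : ℝ)) ω ∈ Set.Icc (0 : ℝ) 1 := by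
  by_cases h : ω ∈ A <;> simp [h]

theorem indicator_one_eq_of_mem_iff {Ω Ω' : Type*} {A : Set Ω} {B : Set Ω'} {ω : Ω} {ω' : Ω'}
    (h : ω ∈ A ↔ ω' ∈ B) :
    A.indicator (fun _ => (1 : ℝ)) ω = B.indicator (fun _ => (1 : ℝ)) ω' := by
  by_cases h' : ω' ∈ B
  · rw [Set.indicator_of_mem h', Set.indicator_of_mem (h.mpr h')]
  · rw [Set.indicator_of_notMem h', Set.indicator_of_notMem (mt h.mp h')]

theorem birkhoffAverage_indicator_permMap_blockPerm {K : Type*} {σ : Equiv.Perm ℤ} {M : ℕ}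
    (hσ : ∀ x : ℤ, (M : ℤ) < |x| → σ x = x) {A : Set (ℤ → K)} (hA : DependsOnWindow M A)
    (n : ℕ) (ω : ℤ → K) :
    birkhoffAverage ℝ ((shift K)^[2 * M + 1]) (A.indicator fun _ => (1 : ℝ)) n
        (permMap K (blockPerm σ (2 * M + 1) n) ω) =
      birkhoffAverage ℝ ((shift K)^[2 * M + 1])
        ((permMap K σ ⁻¹' A).indicator fun _ => (1 : ℝ)) n ω := by
  simp only [birkhoffAverage, birkhoffSum]
  congr 1
  refine Finset.sum_congr rfl fun i hi => ?_
  have h : ((shift K)^[2 * M + 1])^[i] (permMap K (blockPerm σ (2 * M + 1) n) ω) ∈ A ↔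
      ((shift K)^[2 * M + 1])^[i] ω ∈ permMap K σ ⁻¹' A := by
    refine hA _ _ fun k hk => ?_
    rw [shift_iterate_iterate_apply, permMap, permMap, shift_iterate_iterate_apply,
      blockPerm_apply_of_lt hσ (Finset.mem_range.mp hi) hk]
  exact indicator_one_eq_of_mem_iff h

/-- Only the summands of the `n` permuted blocks can change, each by at most 1. -/
theorem abs_birkhoffAverage_indicator_permMap_blockPerm_sub_le {K : Type*} {σ : Equiv.Perm ℤ}
    {M : ℕ} (hσ : ∀ x : ℤ, (M : ℤ) < |x| → σ x = x) {A : Set (ℤ → K)} (hA : DependsOnWindow M A)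
    (n N : ℕ) (ω : ℤ → K) :
    |birkhoffAverage ℝ ((shift K)^[2 * M + 1]) (A.indicator fun _ => (1 : ℝ)) N
        (permMap K (blockPerm σ (2 * M + 1) n) ω) -
      birkhoffAverage ℝ ((shift K)^[2 * M + 1]) (A.indicator fun _ => (1 : ℝ)) N ω| ≤ n / N := by
  simp only [birkhoffAverage, birkhoffSum, smul_eq_mul]
  rw [← mul_sub, ← Finset.sum_sub_distrib, abs_mul, abs_of_nonneg (by positivity), inv_mul_eq_div]
  gcongr
  refine (Finset.abs_sum_le_sum_abs _ _).trans ?_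
  calc ∑ i ∈ Finset.range N, |_|
      ≤ ∑ i ∈ Finset.range N, if i ∈ Finset.range n then (1 : ℝ) else 0 := by
        refine Finset.sum_le_sum fun i _ => ?_
        split_ifs with hi
        · have h1 := indicator_mem_Icc A (((shift K)^[2 * M + 1])^[i] ω)
          have h2 := indicator_mem_Icc A (((shift K)^[2 * M + 1])^[i]
            (permMap K (blockPerm σ (2 * M + 1) n) ω))
          rw [abs_le]
          constructor <;> linarith [h1.1, h1.2, h2.1, h2.2]
        · have h : ((shift K)^[2 * M + 1])^[i] (permMap K (blockPerm σ (2 * M + 1) n) ω) ∈ A ↔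
              ((shift K)^[2 * M + 1])^[i] ω ∈ A := by
            refine hA _ _ fun k hk => ?_
            rw [shift_iterate_iterate_apply, permMap, shift_iterate_iterate_apply,
              blockPerm_apply_of_le hσ (by simpa using hi) hk]
          rw [indicator_one_eq_of_mem_iff h, sub_self, abs_zero]
    _ ≤ n := by
        rw [← Finset.sum_filter, Finset.sum_const, nsmul_eq_mul, mul_one]
        have : (Finset.range N).filter (· ∈ Finset.range n) ⊆ Finset.range n := fun i hi => by
          simpa using (Finset.mem_filter.mp hi).2
        simpa using Finset.card_le_card this

theorem IsQuasiExchangeableUILaw.measureReal_preimage_eq [IsProbabilityMeasure μ]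
    (hμ : IsStationaryLaw μ) (h : IsQuasiExchangeableUILaw μ) {σ : Equiv.Perm ℤ} {M : ℕ}
    (hσ : ∀ x : ℤ, (M : ℤ) < |x| → σ x = x) {A : Set (ℤ → K)} (hAm : MeasurableSet A)
    (hA : DependsOnWindow M A) : μ.real (permMap K σ ⁻¹' A) = μ.real A := by
  set T := (shift K)^[2 * M + 1] with hTdef
  have hT : MeasurePreserving T μ μ := hμ.measurePreserving.iterate _
  set f : (ℤ → K) → ℝ := A.indicator fun _ => (1 : ℝ) with hf
  have hfm : Measurable f := measurable_const.indicator hAm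
  have hf01 : ∀ ω, f ω ∈ Set.Icc (0 : ℝ) 1 := indicator_mem_Icc A
  set a := birkhoffAverage ℝ T f with ha
  have ham : ∀ n, Measurable (a n) := measurable_birkhoffAverage hT.measurable hfm
  have ha01 : ∀ n ω, a n ω ∈ Set.Icc (0 : ℝ) 1 := birkhoffAverage_mem_Icc hf01
  have hai : ∀ n, Integrable (a n) μ := fun n =>
    Integrable.of_mem_Icc 0 1 (ham n).aemeasurable (ae_of_all _ (ha01 n))
  obtain ⟨l, -, hli, -, hlim⟩ := exists_tendsto_integral_abs_birkhoffAverage_sub hT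
    (memLp_of_bounded (ae_of_all _ hf01) hfm.aestronglyMeasurable 2)
  refine eq_of_forall_dist_le fun ε₀ hε₀ => ?_
  -- Two parts go to `hcomp`, one to the `n₀ / N` error.
  set ε := ε₀ / 3 with hε
  have hε0 : 0 < ε := by positivity
  -- This `δ` serves all finite permutations at once, so it may be fixed before `n₀`, on which `ρ`
  -- depends.
  obtain ⟨δ, hδ, hui⟩ := h.2.2.1 hε0
  obtain ⟨n₀, hn₀⟩ := ((hlim.eventually_lt_const (show 0 < δ * ε / 2 by positivity)).and
    (eventually_ne_atTop 0)).exists_forall_of_atTop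
  obtain ⟨N, hN, hNε⟩ : ∃ N, n₀ ≤ N ∧ (n₀ : ℝ) / N ≤ ε := by
    obtain ⟨N, hN⟩ := exists_nat_ge ((n₀ : ℝ) / ε)
    refine ⟨max n₀ N, le_max_left _ _, ?_⟩
    have h0 : 0 < (max n₀ N : ℕ) := lt_max_of_lt_left (Nat.pos_of_ne_zero (hn₀ n₀ le_rfl).2)
    rw [div_le_comm₀ (by exact_mod_cast h0) hε0]
    exact hN.trans (by exact_mod_cast le_max_right _ _)
  set ρ := blockPerm σ (2 * M + 1) n₀ with hρ
  have hρf : ρ ∈ finitePerms := blockPerm_mem_finitePerms hσ _ _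
  have hd01 : ∀ ω, |a n₀ ω - a N ω| ∈ Set.Icc (0 : ℝ) 1 := fun ω =>
    ⟨abs_nonneg _, abs_le.mpr ⟨by linarith [(ha01 n₀ ω).1, (ha01 N ω).2],
      by linarith [(ha01 n₀ ω).2, (ha01 N ω).1]⟩⟩
  have hdm : Measurable fun ω => |a n₀ ω - a N ω| := ((ham n₀).sub (ham N)).abs
  have hdint : ∫ ω, |a n₀ ω - a N ω| ∂μ ≤ δ * ε := by
    calc ∫ ω, |a n₀ ω - a N ω| ∂μ ≤ ∫ ω, (|a n₀ ω - l ω| + |a N ω - l ω|) ∂μ := by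
          refine integral_mono ((hai _).sub (hai _)).abs
            (((hai _).sub hli).abs.add ((hai _).sub hli).abs) fun ω => ?_
          rw [abs_sub_comm (a N ω)]
          exact abs_sub_le _ _ _
      _ = ∫ ω, |a n₀ ω - l ω| ∂μ + ∫ ω, |a N ω - l ω| ∂μ :=
          integral_add ((hai _).sub hli).abs ((hai _).sub hli).abs
      _ ≤ δ * ε := by linarith [(hn₀ n₀ le_rfl).1, (hn₀ N hN).1]
  -- Markov's inequality; this is why the `L¹` distance was made at most `δ * ε`.
  have hsmall : μ {ω | ε < |a n₀ ω - a N ω|} ≤ ENNReal.ofReal δ := by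
    have h1 := mul_meas_ge_le_integral_of_nonneg (ae_of_all μ fun ω => (hd01 ω).1)
      ((hai n₀).sub (hai N)).abs ε
    have h2 : μ.real {ω | ε ≤ |a n₀ ω - a N ω|} ≤ δ := by
      refine le_of_mul_le_mul_left (h1.trans (hdint.trans_eq (mul_comm _ _))) hε0
    have h3 : {ω | ε < |a n₀ ω - a N ω|} ⊆ {ω | ε ≤ |a n₀ ω - a N ω|} :=
      fun ω hω => le_of_lt (Set.mem_ofPred_eq ▸ hω)
    refine (measure_mono h3).trans ?_
    rw [← ofReal_measureReal]
    exact ENNReal.ofReal_le_ofReal h2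
  have hρsmall : μ.map (permMap K ρ) {ω | ε < |a n₀ ω - a N ω|} ≤ ENNReal.ofReal ε := by
    have hms : MeasurableSet {ω | ε < |a n₀ ω - a N ω|} := measurableSet_lt measurable_const hdm
    rw [map_permMap_apply_eq_eLpNorm (h.1 ρ hρf).1 hms]
    exact hui ⟨ρ, hρf⟩ _ hms hsmall
  have hcomp := integral_comp_le_of_measure_le hdm hd01 hε0.le hρsmall
  have hmP := measurable_permMap (K := K) ρ
  have hic : ∀ n, Integrable (fun ω => a n (permMap K ρ ω)) μ := fun n =>
    Integrable.of_mem_Icc 0 1 ((ham n).comp hmP).aemeasurable (ae_of_all _ fun ω => ha01 n _)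
  have hσA : MeasurableSet (permMap K σ ⁻¹' A) := measurable_permMap σ hAm
  have e1 : ∫ ω, a n₀ (permMap K ρ ω) ∂μ = μ.real (permMap K σ ⁻¹' A) := by
    simp_rw [ha, hf, hρ, hTdef, birkhoffAverage_indicator_permMap_blockPerm hσ hA]
    rw [integral_birkhoffAverage hT ((integrable_const _).indicator hσA) (hn₀ n₀ le_rfl).2,
      integral_indicator_const _ hσA]
    simp
  have e2 : ∫ ω, a N ω ∂μ = μ.real A := by
    rw [ha, integral_birkhoffAverage hT ((integrable_const _).indicator hAm) (hn₀ N hN).2,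
      integral_indicator_const _ hAm]
    simp
  rw [Real.dist_eq, ← e1, ← e2, ← integral_sub (hic _) (hai _)]
  calc |∫ ω, (a n₀ (permMap K ρ ω) - a N ω) ∂μ|
      ≤ ∫ ω, |a n₀ (permMap K ρ ω) - a N ω| ∂μ := abs_integral_le_integral_abs
    _ ≤ ∫ ω, (|a n₀ (permMap K ρ ω) - a N (permMap K ρ ω)| + ε) ∂μ := by
        refine integral_mono ((hic _).sub (hai _)).abs
          (((hic _).sub (hic _)).abs.add (integrable_const _)) fun ω => ?_
        refine (abs_sub_le _ (a N (permMap K ρ ω)) _).trans (add_le_add_right ?_ _)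
        exact (abs_birkhoffAverage_indicator_permMap_blockPerm_sub_le hσ hA n₀ N ω).trans hNε
    _ = ∫ ω, |a n₀ (permMap K ρ ω) - a N (permMap K ρ ω)| ∂μ + ε := by
        have hci : Integrable (fun ω => |a n₀ (permMap K ρ ω) - a N (permMap K ρ ω)|) μ :=
          ((hic _).sub (hic _)).abs
        rw [integral_add hci (integrable_const _)]
        simp
    _ ≤ ε₀ := by linarith

theorem IsQuasiExchangeableUILaw.isExchangeableLaw [IsProbabilityMeasure μ]
    (hμ : IsStationaryLaw μ) (h : IsQuasiExchangeableUILaw μ) : IsExchangeableLaw μ := by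
  rintro σ ⟨N, hN⟩
  refine (ext_of_boxes fun s B hB => ?_).symm
  have hAm : MeasurableSet ((s : Set ℤ).pi B) :=
    MeasurableSet.pi s.countable_toSet fun i _ => hB i
  -- One window containing both the support of `σ` and the coordinates of the box.
  set M : ℕ := max N.toNat (s.sup Int.natAbs) with hM
  rw [Measure.map_apply (measurable_permMap σ) hAm]
  refine (measureReal_eq_measureReal_iff (measure_ne_top _ _) (measure_ne_top _ _)).mp
    (h.measureReal_preimage_eq hμ (M := M) (fun x hx => hN x ?_) hAm fun ω ω' hω => ?_).symm
  · have : N.toNat ≤ M := le_max_left _ _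
    omega
  · simp only [Set.mem_pi, Finset.mem_coe]
    refine forall₂_congr fun i hi => ?_
    have h1 : Int.natAbs i ≤ M := (Finset.le_sup (f := Int.natAbs) hi).trans (le_max_right _ _)
    rw [hω i (by rw [Int.abs_eq_natAbs]; exact_mod_cast h1)]

end

/-! ### Almost invariant events and conditional distributions -/

section

variable {Ω : Type*} [mΩ : MeasurableSpace Ω] {μ : Measure Ω} {T : Ω → Ω}

/-- The sigma-algebra of the measurable sets that are invariant under `T` up to null sets. -/
@[reducible] def aeInvariants (μ : Measure Ω) (T : Ω → Ω) : MeasurableSpace Ω where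
  MeasurableSet' s := MeasurableSet s ∧ T ⁻¹' s =ᵐ[μ] s
  measurableSet_empty := ⟨MeasurableSet.empty, by simp⟩
  measurableSet_compl s hs := ⟨hs.1.compl, by simpa using hs.2.compl⟩
  measurableSet_iUnion s hs := ⟨MeasurableSet.iUnion fun i => (hs i).1, by
    rw [Set.preimage_iUnion]
    exact Filter.EventuallyEq.countable_iUnion fun i => (hs i).2⟩

theorem aeInvariants_le (μ : Measure Ω) (T : Ω → Ω) : aeInvariants μ T ≤ mΩ := fun _ hs => hs.1

theorem measurable_aeInvariants {l : Ω → ℝ} (hl : Measurable l)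
    (hlT : l ∘ T =ᵐ[μ] l) : Measurable[aeInvariants μ T] l := fun s hs => by
  refine ⟨hl hs, ?_⟩
  rw [← Set.preimage_comp]
  exact hlT.preimage s

theorem preimage_iterate_ae_eq (hT : MeasurePreserving T μ μ) {s : Set Ω} (hs : T ⁻¹' s =ᵐ[μ] s)
    (k : ℕ) : T^[k] ⁻¹' s =ᵐ[μ] s :=
  hT.quasiMeasurePreserving.preimage_iterate_ae_eq k hs

/-- An `L¹`-limit of ergodic averages is the conditional expectation with respect to the sigma-algebra
of the almost invariant sets. -/
theorem ae_eq_condExp_aeInvariants [IsProbabilityMeasure μ] (hT : MeasurePreserving T μ μ)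
    {f l : Ω → ℝ} (hf : Integrable f μ) (hl : Measurable l) (hli : Integrable l μ)
    (hlT : l ∘ T =ᵐ[μ] l)
    (hlim : Tendsto (fun n : ℕ => ∫ ω, |birkhoffAverage ℝ T f n ω - l ω| ∂μ) atTop (𝓝 0)) :
    l =ᵐ[μ] μ[f | aeInvariants μ T] := by
  refine ae_eq_condExp_of_forall_setIntegral_eq (aeInvariants_le μ T) hf
    (fun _ _ _ => hli.integrableOn) (fun s hs _ => ?_)
    (measurable_aeInvariants hl hlT).stronglyMeasurable.aestronglyMeasurable
  have hk (k : ℕ) : Integrable (fun ω => f (T^[k] ω)) μ :=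
    (hT.iterate k).integrable_comp_of_integrable hf
  -- Replace `s` by its preimage under `T^[k]`, which differs by a null set, and change variables.
  have hki (k : ℕ) : ∫ ω in s, f (T^[k] ω) ∂μ = ∫ ω in s, f ω ∂μ := by
    have hTk := hT.iterate k
    rw [← setIntegral_congr_set (preimage_iterate_ae_eq hT hs.2 k)]
    have := setIntegral_map (μ := μ) (g := T^[k]) (f := f) hs.1
      (by rw [hTk.map_eq]; exact hf.1) hTk.measurable.aemeasurable
    rw [← this, hTk.map_eq]
  have hav (n : ℕ) : Integrable (birkhoffAverage ℝ T f n) μ :=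
    (integrable_finsetSum (Finset.range n) fun k _ => hk k).const_mul (n : ℝ)⁻¹
  have hint (n : ℕ) (hn : n ≠ 0) :
      ∫ ω in s, birkhoffAverage ℝ T f n ω ∂μ = ∫ ω in s, f ω ∂μ := by
    simp only [birkhoffAverage, birkhoffSum, smul_eq_mul]
    rw [integral_const_mul, integral_finsetSum _ fun k _ => (hk k).integrableOn]
    simp only [hki, Finset.sum_const, Finset.card_range, nsmul_eq_mul]
    field_simp
  have h0 : Tendsto (fun n : ℕ => ∫ ω in s, birkhoffAverage ℝ T f n ω ∂μ) atTop
      (𝓝 (∫ ω in s, l ω ∂μ)) := by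
    rw [tendsto_iff_norm_sub_tendsto_zero]
    refine squeeze_zero (fun _ => norm_nonneg _) (fun n => ?_) hlim
    rw [← integral_sub (hav n).integrableOn hli.integrableOn]
    exact (norm_integral_le_integral_norm _).trans
      (setIntegral_le_integral ((hav n).sub hli).norm (ae_of_all _ fun _ => norm_nonneg _))
  refine tendsto_nhds_unique h0 (tendsto_const_nhds.congr' ?_)
  filter_upwards [eventually_ne_atTop 0] with n hn using (hint n hn).symm

/-- Regular conditional distributions given a sub-sigma-algebra. -/
theorem exists_measure_real_ae_eq_condExp [IsFiniteMeasure μ]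
    {E : Type*} [MeasurableSpace E] [StandardBorelSpace E] [Nonempty E] {Y : Ω → E}
    (hY : Measurable Y) {m : MeasurableSpace Ω} (hm : m ≤ mΩ) :
    ∃ κ : Ω → Measure E, (∀ ω, IsProbabilityMeasure (κ ω)) ∧
      ∀ B, MeasurableSet B → (fun ω => (κ ω).real B) =ᵐ[μ] μ[(Y ⁻¹' B).indicator fun _ => (1 : ℝ) | m] := by
  -- Conditioning on the identity, viewed as a map into `Ω` with the smaller sigma-algebra, is
  -- conditioning on `m`.
  have hid : Measurable[mΩ, m] (id : Ω → Ω) := fun s hs => hm s hs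
  refine ⟨fun ω => @ProbabilityTheory.condDistrib Ω Ω E _ _ _ mΩ m Y id μ _ ω, fun ω => ?_,
    fun B hB => ?_⟩
  · infer_instance
  · have := ProbabilityTheory.condDistrib_ae_eq_condExp (mβ := m) (μ := μ) hid hY hB
    simpa only [MeasurableSpace.comap_id, id] using this

end

/-! ### Asymptotic frequencies and conditional independence -/

theorem abs_prod_sub_prod_le_sum {ι : Type*} (s : Finset ι) {u v : ι → ℝ}
    (hu : ∀ i, u i ∈ Set.Icc (0 : ℝ) 1) (hv : ∀ i, v i ∈ Set.Icc (0 : ℝ) 1) :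
    |∏ i ∈ s, u i - ∏ i ∈ s, v i| ≤ ∑ i ∈ s, |u i - v i| := by
  classical
  induction s using Finset.induction_on with
  | empty => simp
  | insert a s ha ih =>
    rw [Finset.prod_insert ha, Finset.prod_insert ha, Finset.sum_insert ha]
    have h1 : |∏ i ∈ s, u i| ≤ 1 := by
      rw [Finset.abs_prod]
      exact Finset.prod_le_one (fun _ _ => abs_nonneg _) fun i _ =>
        abs_le.mpr ⟨by linarith [(hu i).1], (hu i).2⟩
    have h2 : |v a| ≤ 1 := abs_le.mpr ⟨by linarith [(hv a).1], (hv a).2⟩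
    calc |u a * ∏ i ∈ s, u i - v a * ∏ i ∈ s, v i|
        = |(u a - v a) * ∏ i ∈ s, u i + v a * (∏ i ∈ s, u i - ∏ i ∈ s, v i)| := by ring_nf
      _ ≤ |u a - v a| * |∏ i ∈ s, u i| + |v a| * |∏ i ∈ s, u i - ∏ i ∈ s, v i| := by
          rw [← abs_mul, ← abs_mul]
          exact abs_add_le _ _
      _ ≤ |u a - v a| * 1 + 1 * |∏ i ∈ s, u i - ∏ i ∈ s, v i| := by gcongr
      _ ≤ _ := by linarith

/-- An injection of a finite set of integers into the integers extends to a finite permutation. -/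
theorem exists_mem_finitePerms_extending {s : Finset ℤ} {g : s → ℤ} (hg : Function.Injective g) :
    ∃ σ ∈ finitePerms, ∀ i : s, σ i = g i := by
  classical
  -- A partial injection of the finite set `t` into itself extends to a bijection of `t`; outside
  -- `t` nothing moves.
  set t : Finset ℤ := s ∪ Finset.univ.image g with ht
  have hst : s ⊆ t := Finset.subset_union_left
  let f : t → ℤ := fun x => if h : (x : ℤ) ∈ s then g ⟨x, h⟩ else x
  let s' : Finset t := Finset.univ.filter fun x => (x : ℤ) ∈ s
  obtain ⟨e, he⟩ := Finset.exists_equiv_extend_of_card_eq (α := t) (t := t) (by simp)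
    (s := s') (f := f) (by
      intro y hy
      obtain ⟨x, hx, rfl⟩ := Finset.mem_image.mp hy
      have hx' : (x : ℤ) ∈ s := (Finset.mem_filter.mp hx).2
      simp only [f, hx', dif_pos]
      exact Finset.mem_union_right _ (Finset.mem_image_of_mem _ (Finset.mem_univ _)))
    (by
      intro x hx y hy hxy
      have hx' : (x : ℤ) ∈ s := (Finset.mem_filter.mp hx).2
      have hy' : (y : ℤ) ∈ s := (Finset.mem_filter.mp hy).2
      simp only [f, hx', hy', dif_pos] at hxy
      exact Subtype.ext (by simpa using hg hxy))
  refine ⟨Equiv.Perm.ofSubtype (p := (· ∈ t)) e, ?_, fun i => ?_⟩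
  · refine ⟨(t.sup Int.natAbs : ℕ) + 1, fun x hx => ?_⟩
    refine Equiv.Perm.ofSubtype_apply_of_not_mem _ fun hxt => ?_
    have h1 : Int.natAbs x ≤ t.sup Int.natAbs := Finset.le_sup (f := Int.natAbs) hxt
    rw [Int.abs_eq_natAbs] at hx
    omega
  · rw [Equiv.Perm.ofSubtype_apply_of_mem (p := (· ∈ t)) e (hst i.2)]
    have hi : (⟨i, hst i.2⟩ : t) ∈ s' := Finset.mem_filter.mpr ⟨Finset.mem_univ _, i.2⟩
    rw [he _ hi]
    simp [f]

section

variable {K : Type*} [MeasurableSpace K] {μ : Measure (ℤ → K)}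

/-- `l B` is the asymptotic frequency of the visits of the process to the set `B`. -/
structure IsFrequency (μ : Measure (ℤ → K)) (B : Set K) (l : (ℤ → K) → ℝ) : Prop where
  measurable : Measurable l
  mem_Icc : ∀ ω, l ω ∈ Set.Icc (0 : ℝ) 1
  comp_shift : l ∘ shift K =ᵐ[μ] l
  tendsto : Tendsto (fun n : ℕ => ∫ ω, |birkhoffAverage ℝ (shift K)
    (((fun ω : ℤ → K => ω 0) ⁻¹' B).indicator fun _ => (1 : ℝ)) n ω - l ω| ∂μ) atTop (𝓝 0)

theorem exists_isFrequency [IsProbabilityMeasure μ] (hμ : IsStationaryLaw μ) {B : Set K}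
    (hB : MeasurableSet B) : ∃ l, IsFrequency μ B l := by
  have hB0 : MeasurableSet ((fun ω : ℤ → K => ω 0) ⁻¹' B) := measurable_pi_apply 0 hB
  set f := ((fun ω : ℤ → K => ω 0) ⁻¹' B).indicator fun _ => (1 : ℝ)
  have hfm : Measurable f := measurable_const.indicator hB0
  have ha01 := birkhoffAverage_mem_Icc (T := shift K) (indicator_mem_Icc _ : ∀ ω, f ω ∈ _)
  obtain ⟨l, hl, hli, hlT, hlim⟩ := exists_tendsto_integral_abs_birkhoffAverage_sub
    hμ.measurePreserving (memLp_of_bounded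
      (ae_of_all _ (indicator_mem_Icc _ : ∀ ω, f ω ∈ _)) hfm.aestronglyMeasurable 2)
  -- Truncation to `[0, 1]` fixes the averages and is 1-Lipschitz, so the limit survives and is
  -- bounded everywhere.
  refine ⟨fun ω => max (min (l ω) 1) 0, (hl.min measurable_const).max measurable_const,
    fun ω => ⟨le_max_right _ _, max_le (min_le_right _ _) zero_le_one⟩, ?_, ?_⟩
  · filter_upwards [hlT] with ω hω
    simp only [Function.comp_apply] at hω ⊢
    rw [hω]
  · refine squeeze_zero (fun _ => integral_nonneg fun _ => abs_nonneg _) (fun n => ?_) hlim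
    have ham := measurable_birkhoffAverage measurable_shift hfm n
    refine integral_mono_of_nonneg (ae_of_all _ fun _ => abs_nonneg _)
      ((Integrable.of_mem_Icc 0 1 ham.aemeasurable (ae_of_all _ (ha01 n))).sub hli).abs
      (ae_of_all _ fun ω => ?_)
    have h1 : birkhoffAverage ℝ (shift K) f n ω
        = max (min (birkhoffAverage ℝ (shift K) f n ω) 1) 0 := by
      rw [min_eq_left (ha01 n ω).2, max_eq_left (ha01 n ω).1]
    calc |birkhoffAverage ℝ (shift K) f n ω - max (min (l ω) 1) 0|
        = |max (min (birkhoffAverage ℝ (shift K) f n ω) 1) 0 - max (min (l ω) 1) 0| := by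
          rw [← h1]
      _ ≤ |min (birkhoffAverage ℝ (shift K) f n ω) 1 - min (l ω) 1| :=
          abs_max_sub_max_le_abs _ _ _
      _ ≤ max |birkhoffAverage ℝ (shift K) f n ω - l ω| |1 - 1| := abs_min_sub_min_le_max _ _ _ _
      _ = |birkhoffAverage ℝ (shift K) f n ω - l ω| := by simp

namespace IsFrequency

variable {B : Set K} {l : (ℤ → K) → ℝ}

theorem integrable [IsProbabilityMeasure μ] (h : IsFrequency μ B l) : Integrable l μ :=
  Integrable.of_mem_Icc 0 1 h.measurable.aemeasurable (ae_of_all _ h.mem_Icc)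

theorem ae_eq_condExp [IsProbabilityMeasure μ] (h : IsFrequency μ B l) (hμ : IsStationaryLaw μ) (hB : MeasurableSet B) :
    l =ᵐ[μ] μ[((fun ω : ℤ → K => ω 0) ⁻¹' B).indicator fun _ => (1 : ℝ) |
      aeInvariants μ (shift K)] :=
  ae_eq_condExp_aeInvariants hμ.measurePreserving
    ((integrable_const _).indicator (measurable_pi_apply 0 hB)) h.measurable h.integrable
    h.comp_shift h.tendsto

/-- The frequencies along windows that start at any places converge to the same limit. -/
theorem tendsto_shifted (h : IsFrequency μ B l) (hμ : IsStationaryLaw μ) (hB : MeasurableSet B)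
    (k : ℕ → ℕ) :
    Tendsto (fun n : ℕ => ∫ ω, |birkhoffAverage ℝ (shift K)
      (((fun ω : ℤ → K => ω 0) ⁻¹' B).indicator fun _ => (1 : ℝ)) n ((shift K)^[k n] ω) - l ω| ∂μ)
      atTop (𝓝 0) := by
  refine h.tendsto.congr fun n => ?_
  have hk := hμ.measurePreserving.iterate (k n)
  have hlk : l ∘ (shift K)^[k n] =ᵐ[μ] l := by
    induction k n with
    | zero => rfl
    | succ j ih =>
      rw [Function.iterate_succ, ← Function.comp_assoc]
      exact (ih.comp_tendsto hμ.measurePreserving.quasiMeasurePreserving.tendsto_ae).trans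
        h.comp_shift
  have ham := measurable_birkhoffAverage measurable_shift
    ((measurable_const (a := (1 : ℝ))).indicator
      ((measurable_pi_apply 0 : Measurable fun ω : ℤ → K => ω 0) hB)) n
  have hdm : Measurable fun ω => |birkhoffAverage ℝ (shift K)
      (((fun ω : ℤ → K => ω 0) ⁻¹' B).indicator fun _ => (1 : ℝ)) n ω - l ω| :=
    (ham.sub h.measurable).abs
  conv_lhs => rw [← hk.map_eq]
  rw [integral_map hk.measurable.aemeasurable hdm.aestronglyMeasurable]
  refine integral_congr_ae ?_
  filter_upwards [hlk] with ω hω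
  rw [← hω]
  rfl

end IsFrequency

theorem measurableSet_box {ι : Type*} [Finite ι] {B : ι → Set K} (hB : ∀ i, MeasurableSet (B i))
    (g : ι → ℤ) : MeasurableSet {ω : ℤ → K | ∀ i, ω (g i) ∈ B i} := by
  have : {ω : ℤ → K | ∀ i, ω (g i) ∈ B i} = ⋂ i, (fun ω : ℤ → K => ω (g i)) ⁻¹' B i := by
    ext; simp
  rw [this]
  exact MeasurableSet.iInter fun i => measurable_pi_apply (g i) (hB i)

/-- The only point where exchangeability itself enters the construction of the mixture. -/
theorem IsExchangeableLaw.measure_box (h : IsExchangeableLaw μ) {s : Finset ℤ} {B : s → Set K}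
    (hB : ∀ i, MeasurableSet (B i)) {g : s → ℤ} (hg : Function.Injective g) :
    μ {ω | ∀ i, ω (g i) ∈ B i} = μ {ω | ∀ i : s, ω i ∈ B i} := by
  obtain ⟨σ, hσ, hσg⟩ := exists_mem_finitePerms_extending hg
  conv_rhs => rw [← h σ hσ, Measure.map_apply (measurable_permMap σ)
    (measurableSet_box hB fun i : s => (i : ℤ))]
  congr 1
  ext ω
  exact forall_congr' fun i => by rw [permMap, hσg]

/-- Given the asymptotic frequencies, the coordinates of an exchangeable process are independent. -/
theorem IsExchangeableLaw.integral_prod_frequency [IsProbabilityMeasure μ] (hμ : IsStationaryLaw μ)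
    (h : IsExchangeableLaw μ) {s : Finset ℤ} {B : s → Set K} (hB : ∀ i, MeasurableSet (B i))
    {l : s → (ℤ → K) → ℝ} (hl : ∀ i, IsFrequency μ (B i) (l i)) :
    ∫ ω, ∏ i, l i ω ∂μ = μ.real {ω | ∀ i : s, ω i ∈ B i} := by
  classical
  let f : s → (ℤ → K) → ℝ := fun i =>
    ((fun ω : ℤ → K => ω 0) ⁻¹' B i).indicator fun _ => (1 : ℝ)
  -- Distinct labels make the windows `[n * w i, n * w i + n)` disjoint; division by `n` recovers
  -- the label.
  let w : s → ℕ := fun i => Encodable.encode (i : ℤ)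
  have hw : Function.Injective w := Encodable.encode_injective.comp Subtype.val_injective
  let u : ℕ → s → (ℤ → K) → ℝ := fun n i ω =>
    birkhoffAverage ℝ (shift K) (f i) n ((shift K)^[n * w i] ω)
  have hfm : ∀ i, Measurable (f i) := fun i =>
    measurable_const.indicator (measurable_pi_apply 0 (hB i))
  have hum : ∀ n i, Measurable (u n i) := fun n i =>
    (measurable_birkhoffAverage measurable_shift (hfm i) n).comp (measurable_shift.iterate _)
  have hu01 : ∀ n i ω, u n i ω ∈ Set.Icc (0 : ℝ) 1 := fun n i ω =>
    birkhoffAverage_mem_Icc (indicator_mem_Icc _) n _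
  have hui : ∀ n i, Integrable (u n i) μ := fun n i =>
    Integrable.of_mem_Icc 0 1 (hum n i).aemeasurable (ae_of_all _ (hu01 n i))
  have hprod01 : ∀ v : s → ℝ, (∀ i, v i ∈ Set.Icc (0 : ℝ) 1) → ∏ i, v i ∈ Set.Icc (0 : ℝ) 1 :=
    fun v hv => ⟨Finset.prod_nonneg fun i _ => (hv i).1,
      Finset.prod_le_one (fun i _ => (hv i).1) fun i _ => (hv i).2⟩
  have hupi : ∀ n, Integrable (fun ω => ∏ i, u n i ω) μ := fun n =>
    Integrable.of_mem_Icc 0 1 (Finset.measurable_prod _ fun i _ => hum n i).aemeasurable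
      (ae_of_all _ fun ω => hprod01 _ fun i => hu01 n i ω)
  have hlpi : Integrable (fun ω => ∏ i, l i ω) μ :=
    Integrable.of_mem_Icc 0 1 (Finset.measurable_prod _ fun i _ => (hl i).measurable).aemeasurable
      (ae_of_all _ fun ω => hprod01 _ fun i => (hl i).mem_Icc ω)
  have hint (n : ℕ) (hn : n ≠ 0) :
      ∫ ω, ∏ i, u n i ω ∂μ = μ.real {ω | ∀ i : s, ω i ∈ B i} := by
    have h1 : ∀ ω, ∏ i, u n i ω = ((n : ℝ)⁻¹) ^ s.card *
        ∑ J ∈ Fintype.piFinset fun _ : s => Finset.range n,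
          {ω : ℤ → K | ∀ i : s, ω ((J i + n * w i : ℕ) : ℤ) ∈ B i}.indicator
            (fun _ => (1 : ℝ)) ω := by
      intro ω
      simp only [u, birkhoffAverage, birkhoffSum, smul_eq_mul]
      rw [Finset.prod_mul_distrib, Finset.prod_univ_sum]
      congr 1
      · simp
      · refine Finset.sum_congr rfl fun J _ => ?_
        by_cases hJ : ∀ i : s, ω ((J i + n * w i : ℕ) : ℤ) ∈ B i
        · rw [Set.indicator_of_mem (by exact hJ)]
          refine Finset.prod_eq_one fun i _ => ?_
          refine Set.indicator_of_mem ?_ _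
          rw [← Function.iterate_add_apply, Set.mem_preimage, shift_iterate_apply, zero_add]
          exact hJ i
        · rw [Set.indicator_of_notMem (by exact hJ)]
          push Not at hJ
          obtain ⟨i, hi⟩ := hJ
          refine Finset.prod_eq_zero (Finset.mem_univ i) ?_
          refine Set.indicator_of_notMem ?_ _
          rw [← Function.iterate_add_apply, Set.mem_preimage, shift_iterate_apply, zero_add]
          exact hi
    have h2 : ∀ J ∈ Fintype.piFinset fun _ : s => Finset.range n,
        μ.real {ω : ℤ → K | ∀ i : s, ω ((J i + n * w i : ℕ) : ℤ) ∈ B i}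
          = μ.real {ω | ∀ i : s, ω i ∈ B i} := by
      intro J hJ
      rw [measureReal_def, h.measure_box hB (g := fun i => ((J i + n * w i : ℕ) : ℤ)),
        measureReal_def]
      intro i j hij
      have hij' : J i + n * w i = J j + n * w j := Int.ofNat_inj.mp hij
      have hi : J i < n := Finset.mem_range.mp (Fintype.mem_piFinset.mp hJ i)
      have hj : J j < n := Finset.mem_range.mp (Fintype.mem_piFinset.mp hJ j)
      refine hw ?_
      have h3 := congrArg (· / n) hij'
      simpa [Nat.add_mul_div_left _ _ (Nat.pos_of_ne_zero hn), Nat.div_eq_of_lt hi,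
        Nat.div_eq_of_lt hj] using h3
    have hms := fun J : s → ℕ =>
      measurableSet_box hB fun i : s => ((J i + n * w i : ℕ) : ℤ)
    simp_rw [h1]
    rw [integral_const_mul, integral_finsetSum _ fun J _ => (integrable_const _).indicator (hms J)]
    simp_rw [fun J : s → ℕ => integral_indicator_const (μ := μ) (1 : ℝ) (hms J), smul_eq_mul, mul_one]
    rw [Finset.sum_congr rfl h2, Finset.sum_const, Fintype.card_piFinset]
    simp only [Finset.card_range, Finset.prod_const, Finset.card_univ, Fintype.card_coe,
      nsmul_eq_mul, Nat.cast_pow]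
    rw [← mul_assoc, ← mul_pow, inv_mul_cancel₀ (by exact_mod_cast hn), one_pow, one_mul]
  have hlim : Tendsto (fun n => ∫ ω, ∏ i, u n i ω ∂μ) atTop (𝓝 (∫ ω, ∏ i, l i ω ∂μ)) := by
    rw [tendsto_iff_norm_sub_tendsto_zero]
    have h0 : Tendsto (fun n : ℕ => ∑ i, ∫ ω, |u n i ω - l i ω| ∂μ) atTop (𝓝 0) := by
      have := tendsto_finsetSum (Finset.univ : Finset s)
        fun i _ => (hl i).tendsto_shifted hμ (hB i) fun n => n * w i
      simpa using this
    refine squeeze_zero (fun _ => norm_nonneg _) (fun n => ?_) h0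
    have hd : ∀ i, Integrable (fun ω => |u n i ω - l i ω|) μ := fun i =>
      ((hui n i).sub (hl i).integrable).abs
    rw [← integral_sub (hupi n) hlpi, ← integral_finsetSum _ fun i _ => hd i]
    refine (norm_integral_le_integral_norm _).trans (integral_mono ((hupi n).sub hlpi).norm
      (integrable_finsetSum _ fun i _ => hd i) fun ω => ?_)
    exact abs_prod_sub_prod_le_sum _ (fun i => hu01 n i ω) fun i => (hl i).mem_Icc ω
  refine tendsto_nhds_unique hlim (tendsto_const_nhds.congr' ?_)
  filter_upwards [eventually_ne_atTop 0] with n hn using (hint n hn).symm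

end

/-! ### Construction of the mixing measure -/

/-- A measure on `P` for which the range of `ι : M → P` has full outer measure is the image of a
measure on `M` for the sigma-algebra induced by `ι`. -/
theorem exists_map_eq_of_forall_range_subset {M P : Type*} [mM : MeasurableSpace M]
    [mP : MeasurableSpace P] {ι : M → P} (hι : Measurable ι) (hle : mM ≤ mP.comap ι)
    {ρ : Measure P} (hρ : ∀ A, MeasurableSet A → Set.range ι ⊆ A → ρ Aᶜ = 0) :
    ∃ β : Measure M, β.map ι = ρ := by
  let o : OuterMeasure M := OuterMeasure.comap ι ρ.toOuterMeasure
  have ho : ∀ s, o s = ρ (ι '' s) := fun s => rfl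
  have hcar : mM ≤ o.caratheodory := by
    intro s hs
    obtain ⟨A, hA, rfl⟩ := hle s hs
    intro t
    rw [ho, ho, ho, Set.image_inter_preimage, Set.sdiff_eq, ← Set.preimage_compl,
      Set.image_inter_preimage, ← Set.sdiff_eq]
    exact (measure_inter_add_sdiff _ hA).symm
  refine ⟨o.toMeasure hcar, ?_⟩
  ext A hA
  rw [Measure.map_apply hι hA, toMeasure_apply _ _ (hι hA), ho, Set.image_preimage_eq_inter_range]
  refine le_antisymm (measure_mono Set.inter_subset_left) ?_
  set C := toMeasurable ρ (A ∩ Set.range ι) with hC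
  have hCm : MeasurableSet C := measurableSet_toMeasurable _ _
  -- `C ∪ Aᶜ` is a measurable set containing the range, so the hull `C` has lost no mass of `A`.
  have h0 : ρ (C ∪ Aᶜ)ᶜ = 0 := by
    refine hρ _ (hCm.union hA.compl) fun x hx => ?_
    by_cases hxA : x ∈ A
    · exact Or.inl (subset_toMeasurable _ _ ⟨hxA, hx⟩)
    · exact Or.inr hxA
  calc ρ A ≤ ρ (C ∪ (C ∪ Aᶜ)ᶜ) := measure_mono fun x hx => by
        by_cases hxC : x ∈ C
        · exact Or.inl hxC
        · exact Or.inr fun h => h.elim hxC fun h' => h' hx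
    _ ≤ ρ C + ρ (C ∪ Aᶜ)ᶜ := measure_union_le _ _
    _ = ρ (A ∩ Set.range ι) := by rw [h0, add_zero, hC, measure_toMeasurable]

theorem comap_restrict_mono {X ι E : Type*} [MeasurableSpace E] (f : ι → X → E) {c d : Set ι}
    (h : c ⊆ d) : MeasurableSpace.comap (fun x (i : c) => f i x) MeasurableSpace.pi ≤
      MeasurableSpace.comap (fun x (i : d) => f i x) MeasurableSpace.pi := by
  have : (fun x (i : c) => f i x) =
      (fun (y : d → E) (i : c) => y ⟨i, h i.2⟩) ∘ fun x (i : d) => f i x := rfl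
  rw [this, ← MeasurableSpace.comap_comp]
  refine MeasurableSpace.comap_mono (Measurable.comap_le ?_)
  exact measurable_pi_lambda _ fun i => measurable_pi_apply _

/-- A set that is measurable with respect to a family of functions depends on only countably many
of them. -/
theorem exists_countable_eq_preimage {X ι E : Type*} [mE : MeasurableSpace E] (f : ι → X → E)
    {s : Set X} (hs : MeasurableSet[⨆ i, MeasurableSpace.comap (f i) mE] s) :
    ∃ c : Set ι, c.Countable ∧
      MeasurableSet[MeasurableSpace.comap (fun x (i : c) => f i x) MeasurableSpace.pi] s := by
  -- The sets with countable dependence already form a sigma-algebra.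
  let m : MeasurableSpace X :=
    { MeasurableSet' := fun s => ∃ c : Set ι, c.Countable ∧
        MeasurableSet[MeasurableSpace.comap (fun x (i : c) => f i x) MeasurableSpace.pi] s
      measurableSet_empty := ⟨∅, Set.countable_empty,
        @MeasurableSet.empty _ (MeasurableSpace.comap _ _)⟩
      measurableSet_compl := fun s ⟨c, hc, h⟩ => ⟨c, hc,
        @MeasurableSet.compl _ _ (MeasurableSpace.comap _ _) h⟩
      measurableSet_iUnion := fun s h => by
        choose c hc h using h
        exact ⟨⋃ n, c n, Set.countable_iUnion hc,
          @MeasurableSet.iUnion _ _ (MeasurableSpace.comap _ _) _ _ fun n =>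
          comap_restrict_mono f (Set.subset_iUnion c n) _ (h n)⟩ }
  have hle : (⨆ i, MeasurableSpace.comap (f i) mE) ≤ m := by
    refine iSup_le fun i => ?_
    rintro _ ⟨B, hB, rfl⟩
    exact ⟨{i}, Set.countable_singleton i, fun y => y ⟨i, rfl⟩ ∈ B, measurable_pi_apply _ hB, rfl⟩
  exact hle s hs

section

variable {K : Type*} [mK : MeasurableSpace K] {μ : Measure (ℤ → K)}

/-- The values of a probability measure, as a function on the sigma-algebra. -/
def evalSets (K : Type*) [MeasurableSpace K] (p : ProbabilityMeasure K) :
    {B : Set K // MeasurableSet B} → ℝ := fun B => (p : Measure K).real B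

theorem measurable_evalSets : Measurable (evalSets K) :=
  measurable_pi_lambda _ fun B =>
    ((Measure.measurable_coe B.2).comp measurable_subtype_coe).ennreal_toReal

theorem measurableSpace_probabilityMeasure_le :
    (inferInstance : MeasurableSpace (ProbabilityMeasure K)) ≤
      MeasurableSpace.comap (evalSets K) MeasurableSpace.pi := by
  have h : ∀ B : Set K, MeasurableSet B →
      Measurable[MeasurableSpace.comap (evalSets K) MeasurableSpace.pi]
        fun p : ProbabilityMeasure K => (p : Measure K) B := by
    intro B hB
    have h1 : (fun p : ProbabilityMeasure K => (p : Measure K) B) =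
        (fun x : {B : Set K // MeasurableSet B} → ℝ => ENNReal.ofReal (x ⟨B, hB⟩)) ∘
          evalSets K := by
      ext p
      simp [evalSets]
    rw [h1]
    exact (ENNReal.measurable_ofReal.comp (measurable_pi_apply _)).comp (comap_measurable _)
  have h2 : Measurable[MeasurableSpace.comap (evalSets K) MeasurableSpace.pi]
      (Subtype.val : ProbabilityMeasure K → Measure K) :=
    @Measure.measurable_of_measurable_coe _ _ _
      (MeasurableSpace.comap (evalSets K) MeasurableSpace.pi) _ h
  exact h2.comap_le

/-- An exchangeable process is a mixture of Bernoulli processes as soon as the asymptotic frequencies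
of any countably many sets are almost surely the values of a probability measure. -/
theorem IsExchangeableLaw.isBernoulliMixture [IsProbabilityMeasure μ] (hμ : IsStationaryLaw μ)
    (h : IsExchangeableLaw μ) {l : {B : Set K // MeasurableSet B} → (ℤ → K) → ℝ}
    (hl : ∀ B : {B : Set K // MeasurableSet B}, IsFrequency μ (B : Set K) (l B))
    (hD : ∀ D : Set {B : Set K // MeasurableSet B}, D.Countable →
      ∀ᵐ ω ∂μ, ∃ p : ProbabilityMeasure K, ∀ B ∈ D, (p : Measure K).real B = l B ω) :
    IsBernoulliMixture μ := by
  let G : (ℤ → K) → {B : Set K // MeasurableSet B} → ℝ := fun ω B => l B ω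
  have hG : Measurable G := measurable_pi_lambda _ fun B => (hl B).measurable
  -- The range of `evalSets` need not be measurable; full outer measure suffices, and `A` involves
  -- only countably many frequencies.
  have hthick : ∀ A, MeasurableSet A → Set.range (evalSets K) ⊆ A → μ.map G Aᶜ = 0 := by
    intro A hA hAr
    obtain ⟨D, hDc, A', -, hA'⟩ := exists_countable_eq_preimage
      (fun (B : {B : Set K // MeasurableSet B}) (x : {B : Set K // MeasurableSet B} → ℝ) => x B) hA
    rw [Measure.map_apply hG hA.compl]
    have : ∀ᵐ ω ∂μ, G ω ∈ A := by
      filter_upwards [hD D hDc] with ω ⟨p, hp⟩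
      have h1 : evalSets K p ∈ A := hAr ⟨p, rfl⟩
      rw [← hA'] at h1 ⊢
      have h2 : (fun B : D => G ω B) = fun B : D => evalSets K p B :=
        funext fun B => (hp B B.2).symm
      change (fun B : D => G ω B) ∈ A'
      rw [h2]
      exact h1
    exact this
  obtain ⟨β, hβ⟩ := exists_map_eq_of_forall_range_subset measurable_evalSets
    measurableSpace_probabilityMeasure_le hthick
  have hβ1 : IsProbabilityMeasure β := ⟨by
    have := Measure.isProbabilityMeasure_map (μ := μ) hG.aemeasurable
    rw [← Set.preimage_univ (f := evalSets K), ← Measure.map_apply measurable_evalSets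
      MeasurableSet.univ, hβ, measure_univ]⟩
  refine ⟨β, hβ1, fun A hA => ?_⟩
  rw [← Measure.bind_apply hA measurable_bernoulliLaw.aemeasurable]
  congr 1
  refine ext_of_boxes fun s B hB => ?_
  have hbox : (s : Set ℤ).pi B = {ω | ∀ i : s, ω i ∈ B i} := by
    ext ω; simp [Set.mem_pi]
  rw [Measure.bind_apply (MeasurableSet.pi s.countable_toSet fun i _ => hB i)
    measurable_bernoulliLaw.aemeasurable]
  let F : ({B : Set K // MeasurableSet B} → ℝ) → ℝ≥0∞ := fun x =>
    ENNReal.ofReal (∏ i : s, x ⟨B i, hB i⟩)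
  have hF : Measurable F := ENNReal.measurable_ofReal.comp
    (Finset.measurable_prod _ fun i _ => measurable_pi_apply _)
  have h1 : ∀ p : ProbabilityMeasure K, bernoulliLaw p ((s : Set ℤ).pi B) = F (evalSets K p) := by
    intro p
    rw [bernoulliLaw, Measure.infinitePi_pi _ fun i _ => hB i]
    simp only [F, evalSets]
    rw [ENNReal.ofReal_prod_of_nonneg fun _ _ => measureReal_nonneg]
    exact (Finset.prod_coe_sort s fun i => (p : Measure K) (B i)).symm.trans
      (Finset.prod_congr rfl fun i _ => (ofReal_measureReal (measure_ne_top _ _)).symm)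
  simp_rw [h1]
  rw [← lintegral_map hF measurable_evalSets, hβ, lintegral_map hF hG]
  have hl01 : ∀ ω, ∏ i : s, l ⟨B i, hB i⟩ ω ∈ Set.Icc (0 : ℝ) 1 := fun ω =>
    ⟨Finset.prod_nonneg fun i _ => ((hl _).mem_Icc ω).1,
      Finset.prod_le_one (fun i _ => ((hl _).mem_Icc ω).1) fun i _ => ((hl _).mem_Icc ω).2⟩
  rw [hbox, ← ofReal_measureReal, ← h.integral_prod_frequency hμ (fun i : s => hB i)
    (fun i : s => hl ⟨B i, hB i⟩)]
  exact ofReal_integral_eq_lintegral_ofReal (Integrable.of_mem_Icc 0 1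
    (Finset.measurable_prod _ fun i _ => (hl _).measurable).aemeasurable (ae_of_all _ hl01))
    (ae_of_all _ fun ω => (hl01 ω).1)

/-- The kernel is the regular conditional distribution of `φ (ω 0)` given the almost invariant
events. The exceptional null set depends on `B`, hence the restriction to countable families later.
-/
theorem exists_measure_real_ae_eq_frequency [IsProbabilityMeasure μ] (hμ : IsStationaryLaw μ)
    {l : {B : Set K // MeasurableSet B} → (ℤ → K) → ℝ}
    (hl : ∀ B : {B : Set K // MeasurableSet B}, IsFrequency μ (B : Set K) (l B)) {E : Type*} [MeasurableSpace E]
    [StandardBorelSpace E] [Nonempty E] {φ : K → E} (hφ : Measurable φ) :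
    ∃ κ : (ℤ → K) → Measure E, (∀ ω, IsProbabilityMeasure (κ ω)) ∧
      ∀ B (hB : MeasurableSet B), (fun ω => (κ ω).real B) =ᵐ[μ] l ⟨φ ⁻¹' B, hφ hB⟩ := by
  obtain ⟨κ, hκ, hκB⟩ := exists_measure_real_ae_eq_condExp (μ := μ)
    (hφ.comp (measurable_pi_apply (0 : ℤ))) (aeInvariants_le μ (shift K))
  exact ⟨κ, hκ, fun B hB => (hκB B hB).trans ((hl ⟨φ ⁻¹' B, hφ hB⟩).ae_eq_condExp hμ (hφ hB)).symm⟩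

theorem IsExchangeableLaw.isBernoulliMixture_of_standardBorelSpace [StandardBorelSpace K]
    [IsProbabilityMeasure μ] (hμ : IsStationaryLaw μ) (h : IsExchangeableLaw μ) :
    IsBernoulliMixture μ := by
  choose l hl using fun B : {B : Set K // MeasurableSet B} => exists_isFrequency hμ B.2
  have : Nonempty K := (μ.nonempty_of_neZero).map fun ω => ω 0
  obtain ⟨κ, hκ, hκB⟩ := exists_measure_real_ae_eq_frequency hμ hl measurable_id
  refine h.isBernoulliMixture hμ hl fun D hD => ?_
  filter_upwards [(ae_ball_iff hD).mpr fun B _ => hκB B B.2] with ω hω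
  exact ⟨⟨κ ω, hκ ω⟩, fun B hB => hω B hB⟩

end

/-! ### Baire spaces and lifting through the one-point compactification -/

/-- A probability measure that is carried by the image of a compact Hausdorff space is the image of
a Borel probability measure. -/
theorem exists_map_eq_of_measure_compl_range {X Y : Type*} [TopologicalSpace X] [CompactSpace X]
    [T2Space X] [MeasurableSpace X] [BorelSpace X] [TopologicalSpace Y] [MeasurableSpace Y]
    [BorelSpace Y] [HasOuterApproxClosed Y] (ψ : C(X, Y)) (ν : Measure Y) [IsProbabilityMeasure ν]
    (hν : ν (Set.range ψ)ᶜ = 0) :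
    ∃ π : Measure X, IsProbabilityMeasure π ∧ π.map ψ = ν := by
  have hae : ∀ᵐ y ∂ν, y ∈ Set.range ψ := hν
  let R : (Y →ᵇ ℝ) →ₗ[ℝ] C(X, ℝ) :=
    { toFun := fun h => h.toContinuousMap.comp ψ
      map_add' := fun _ _ => rfl
      map_smul' := fun _ _ => rfl }
  have hRle : ∀ h h' : Y →ᵇ ℝ, R h ≤ R h' → ∫ y, h y ∂ν ≤ ∫ y, h' y ∂ν := by
    intro h h' hh
    refine integral_mono_ae (h.integrable ν) (h'.integrable ν) ?_
    filter_upwards [hae] with y hy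
    obtain ⟨x, rfl⟩ := hy
    exact hh x
  have hReq : ∀ h h' : Y →ᵇ ℝ, R h = R h' → ∫ y, h y ∂ν = ∫ y, h' y ∂ν := fun h h' hh =>
    le_antisymm (hRle _ _ hh.le) (hRle _ _ hh.ge)
  -- Integration against `ν`, seen as a functional of `h ∘ ψ`: well defined because `ν` is carried
  -- by the range of `ψ`.
  let f : C(X, ℝ) →ₗ.[ℝ] ℝ :=
    { domain := LinearMap.range R
      toFun :=
        { toFun := fun x => ∫ y, (Classical.choose x.2) y ∂ν
          map_add' := fun x x' => by
            rw [← integral_add (BoundedContinuousFunction.integrable _ _)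
              (BoundedContinuousFunction.integrable _ _)]
            refine hReq _ (Classical.choose x.2 + Classical.choose x'.2) ?_
            rw [map_add, Classical.choose_spec x.2, Classical.choose_spec x'.2,
              Classical.choose_spec (x + x').2]
            rfl
          map_smul' := fun a x => by
            rw [RingHom.id_apply, smul_eq_mul, ← integral_const_mul]
            refine hReq _ (a • Classical.choose x.2) ?_
            rw [map_smul, Classical.choose_spec x.2, Classical.choose_spec (a • x).2]
            rfl } }
  have hf : ∀ h : Y →ᵇ ℝ, f ⟨R h, h, rfl⟩ = ∫ y, h y ∂ν := fun h =>
    hReq _ _ (Classical.choose_spec (⟨h, rfl⟩ : R h ∈ LinearMap.range R))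
  -- A positive extension to all of `C(X, ℝ)` exists because the domain contains the constants;
  -- Riesz–Markov–Kakutani then represents it by a measure.
  obtain ⟨g, hgf, hg0⟩ := riesz_extension (PointedCone.positive ℝ C(X, ℝ)) f
    (by
      rintro ⟨_, h, rfl⟩ hx
      rw [hf]
      have := hRle 0 h (by simpa using hx)
      simpa using this)
    (by
      intro F
      refine ⟨⟨R (BoundedContinuousFunction.const Y ‖F‖), _, rfl⟩, ?_⟩
      rw [PointedCone.mem_positive]
      intro x
      have := F.norm_coe_le_norm x
      rw [Real.norm_eq_abs] at this
      change 0 ≤ ‖F‖ + F x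
      linarith [neg_le_of_abs_le this])
  let Λ : C_c(X, ℝ) →ₚ[ℝ] ℝ := PositiveLinearMap.mk₀
    { toFun := fun F => g F.toContinuousMap
      map_add' := fun F F' => by rw [← map_add]; rfl
      map_smul' := fun a F => by rw [RingHom.id_apply, ← map_smul]; rfl }
    fun F hF => hg0 _ (by rw [PointedCone.mem_positive]; exact fun x => hF x)
  set π := RealRMK.rieszMeasure Λ with hπ
  have hint : ∀ F : C(X, ℝ), ∫ x, F x ∂π = g F := fun F =>
    RealRMK.integral_rieszMeasure Λ (CompactlySupportedContinuousMap.continuousMapEquiv F)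
  have hinth : ∀ h : Y →ᵇ ℝ, ∫ x, h (ψ x) ∂π = ∫ y, h y ∂ν := fun h => by
    rw [← hf, ← hgf]
    exact hint (R h)
  have hπ1 : IsProbabilityMeasure π := by
    have h1 := hinth (BoundedContinuousFunction.const Y 1)
    simp only [BoundedContinuousFunction.const_apply, integral_const, smul_eq_mul, mul_one,
      probReal_univ] at h1
    rw [measureReal_def, ENNReal.toReal_eq_one_iff] at h1
    exact ⟨h1⟩
  refine ⟨π, hπ1, ?_⟩
  have := Measure.isProbabilityMeasure_map (μ := π) ψ.continuous.measurable.aemeasurable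
  refine ext_of_forall_integral_eq_of_IsFiniteMeasure fun h => ?_
  rw [integral_map ψ.continuous.measurable.aemeasurable h.continuous.aestronglyMeasurable]
  exact hinth h

section

variable {K : Type*} [TopologicalSpace K]

/-- The joint extension to the one-point compactification, by zero at infinity, of continuous functions
with compact support. -/
def extendByZero (c : Set {f : K → ℝ // Continuous f ∧ HasCompactSupport f}) [T2Space K] :
    C(OnePoint K, c → ℝ) where
  toFun x f := x.elim 0 f.1.1
  continuous_toFun := by
    refine continuous_pi fun f => ?_
    rw [OnePoint.continuous_iff, coclosedCompact_eq_cocompact]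
    exact ⟨f.1.2.2.is_zero_at_infty, f.1.2.1⟩

variable [mK : MeasurableSpace K]

theorem measurable_of_hasCompactSupport (hm : mK = baireSigmaAlgebra K)
    (f : {f : K → ℝ // Continuous f ∧ HasCompactSupport f}) : Measurable (f : K → ℝ) := by
  rw [measurable_iff_comap_le, hm]
  exact le_iSup (fun f : {f : K → ℝ // Continuous f ∧ HasCompactSupport f} =>
    MeasurableSpace.comap (f : K → ℝ) (borel ℝ)) f

variable [T2Space K] [LocallyCompactSpace K]

/-- Lifting of a law of countably many continuous functions with compact support to a Baire
probability measure. -/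
theorem exists_probabilityMeasure_map_eq (hm : mK = baireSigmaAlgebra K) [Nonempty K]
    {c : Set {f : K → ℝ // Continuous f ∧ HasCompactSupport f}} (hc : c.Countable)
    (ν : Measure (c → ℝ)) [IsProbabilityMeasure ν]
    (hν : ν (Set.range (extendByZero c))ᶜ = 0)
    (hν0 : (∀ x : K, (fun f : c => f.1.1 x) ≠ 0) → ν {0} = 0) :
    ∃ p : ProbabilityMeasure K, (p : Measure K).map (fun x (f : c) => f.1.1 x) = ν := by
  have := hc.to_subtype
  let _ : MeasurableSpace (OnePoint K) := borel _
  have : BorelSpace (OnePoint K) := ⟨rfl⟩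
  let _ := TopologicalSpace.metrizableSpaceMetric (c → ℝ)
  obtain ⟨π, hπ, hπν⟩ := exists_map_eq_of_measure_compl_range (extendByZero c) ν hν
  have hφ : Measurable fun x (f : c) => (f.1.1 x : ℝ) :=
    measurable_pi_lambda _ fun f => measurable_of_hasCompactSupport hm f.1
  -- The mass at infinity must move into `K` without changing the image law. Either all functions of
  -- `c` vanish at some `x₀`, or `ν {0} = 0` and there is no such mass.
  obtain ⟨x₀, hx₀⟩ : ∃ x₀ : K,
      ∀ᵐ x ∂π, x = OnePoint.infty → (fun f : c => f.1.1 x₀) = 0 := by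
    by_cases h : ∃ x₀ : K, (fun f : c => f.1.1 x₀) = 0
    · obtain ⟨x₀, hx₀⟩ := h
      exact ⟨x₀, ae_of_all _ fun _ _ => hx₀⟩
    · push Not at h
      refine ⟨Classical.arbitrary K, ?_⟩
      have h0 : π (extendByZero c ⁻¹' {0}) = 0 := by
        rw [← Measure.map_apply (extendByZero c).continuous.measurable (measurableSet_singleton 0),
          hπν]
        exact hν0 h
      have h1 : ∀ᵐ x ∂π, x ∉ extendByZero c ⁻¹' {0} := measure_eq_zero_iff_ae_notMem.mp h0
      filter_upwards [h1] with x hx hxi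
      subst hxi
      exact absurd rfl hx
  let r : OnePoint K → K := fun x => x.elim x₀ id
  have hr : Measurable r := by
    rw [measurable_iff_comap_le, hm, MeasurableSpace.comap_iSup]
    refine iSup_le fun f => ?_
    rw [MeasurableSpace.comap_comp, ← measurable_iff_comap_le]
    have h1 : (f : K → ℝ) ∘ r = fun x => extendByZero {f} x ⟨f, rfl⟩ +
        ({OnePoint.infty} : Set (OnePoint K)).indicator (fun _ => f.1 x₀) x := by
      ext x
      induction x using OnePoint.rec with
      | infty => simp [r, extendByZero]
      | coe x => simp [r, extendByZero]
    rw [h1]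
    exact (((continuous_apply _).comp (extendByZero {f}).continuous).measurable).add
      (measurable_const.indicator (measurableSet_singleton _))
  refine ⟨⟨π.map r, Measure.isProbabilityMeasure_map hr.aemeasurable⟩, ?_⟩
  change (π.map r).map _ = ν
  rw [Measure.map_map hφ hr, ← hπν]
  refine Measure.map_congr ?_
  filter_upwards [hx₀] with x hx
  induction x using OnePoint.rec with
  | infty => exact hx rfl
  | coe x => rfl

/-- Countably many Baire sets are preimages under countably many functions with compact support;
these map `K` into a standard Borel space, where conditional distributions exist. -/
theorem IsExchangeableLaw.isBernoulliMixture_of_baire (hm : mK = baireSigmaAlgebra K)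
    {μ : Measure (ℤ → K)} [IsProbabilityMeasure μ] (hμ : IsStationaryLaw μ)
    (h : IsExchangeableLaw μ) : IsBernoulliMixture μ := by
  choose l hl using fun B : {B : Set K // MeasurableSet B} => exists_isFrequency hμ B.2
  have hK : Nonempty K := (μ.nonempty_of_neZero).map fun ω => ω 0
  refine h.isBernoulliMixture hμ hl fun D hD => ?_
  have hdep : ∀ B : {B : Set K // MeasurableSet B},
      ∃ c : Set {f : K → ℝ // Continuous f ∧ HasCompactSupport f}, c.Countable ∧
      MeasurableSet[MeasurableSpace.comap (fun x (f : c) => f.1.1 x) MeasurableSpace.pi]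
        (B : Set K) := by
    intro B
    refine exists_countable_eq_preimage
      (fun (f : {f : K → ℝ // Continuous f ∧ HasCompactSupport f}) => f.1) ?_
    exact hm.le _ B.2
  choose c₀ hc₀ hBc using hdep
  set c := ⋃ B ∈ D, c₀ B with hcdef
  have hc : c.Countable := hD.biUnion fun B _ => hc₀ B
  have := hc.to_subtype
  have hφ : Measurable fun x (f : c) => (f.1.1 x : ℝ) :=
    measurable_pi_lambda _ fun f => measurable_of_hasCompactSupport hm f.1
  obtain ⟨κ, hκ, hκB⟩ := exists_measure_real_ae_eq_frequency hμ hl hφ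
  have hpre : ∀ B ∈ D, ∃ A : Set (c → ℝ), MeasurableSet A ∧
      (fun x (f : c) => f.1.1 x) ⁻¹' A = (B : Set K) := fun B hB =>
    comap_restrict_mono (fun (f : {f : K → ℝ // Continuous f ∧ HasCompactSupport f}) => f.1)
      (Set.subset_biUnion_of_mem hB) _ (hBc B)
  choose! A hAm hAB using hpre
  -- Sets that the functions of `c` never hit have frequency zero. This gives both conditions of the
  -- lifting: mass on the compact image only, and no mass at 0 if 0 is not attained on `K`.
  have hnull : ∀ S : Set (c → ℝ), MeasurableSet S →
      (fun x (f : c) => (f.1.1 x : ℝ)) ⁻¹' S = ∅ → ∀ᵐ ω ∂μ, κ ω S = 0 := by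
    intro S hS hS0
    have h1 := (hl ⟨_, hφ hS⟩).ae_eq_condExp hμ (hφ hS)
    simp only [hS0, Set.preimage_empty, Set.indicator_empty] at h1
    filter_upwards [hκB S hS, h1] with ω h2 h3
    simp only [hS0] at h2
    rw [h3] at h2
    have h4 : (μ[fun _ => (0 : ℝ) | aeInvariants μ (shift K)]) ω = 0 := by
      have := condExp_zero (μ := μ) (m := aeInvariants μ (shift K)) (E := ℝ)
      exact congrFun this ω
    rw [h4] at h2
    exact (measureReal_eq_zero_iff (measure_ne_top _ _)).mp h2
  have hrange : MeasurableSet (Set.range (extendByZero c)) :=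
    (isCompact_range (extendByZero c).continuous).isClosed.measurableSet
  have h1 : ∀ᵐ ω ∂μ, κ ω (Set.range (extendByZero c))ᶜ = 0 := by
    refine hnull _ hrange.compl (Set.eq_empty_of_forall_notMem fun x hx => hx ⟨(x : OnePoint K), rfl⟩)
  have h2 : ∀ᵐ ω ∂μ, (∀ x : K, (fun f : c => f.1.1 x) ≠ 0) → κ ω {0} = 0 := by
    by_cases hx : ∀ x : K, (fun f : c => f.1.1 x) ≠ 0
    · filter_upwards [hnull {0} (measurableSet_singleton 0)
        (Set.eq_empty_of_forall_notMem fun x hx' => hx x hx')] with ω hω _ using hω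
    · exact ae_of_all _ fun ω h => absurd h hx
  filter_upwards [h1, h2, (ae_ball_iff hD).mpr fun B hB => hκB (A B) (hAm B hB)] with ω h1 h2 h3
  obtain ⟨p, hp⟩ := exists_probabilityMeasure_map_eq hm hc (κ ω) h1 h2
  refine ⟨p, fun B hB => ?_⟩
  have h4 := h3 B hB
  have h5 : (⟨_, hφ (hAm B hB)⟩ : {B : Set K // MeasurableSet B}) = B := Subtype.ext (hAB B hB)
  rw [h5, ← hp, map_measureReal_apply hφ (hAm B hB), hAB B hB] at h4
  exact h4

end

end

theorem theorem2 {K : Type*} [MeasurableSpace K]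
    (μ : Measure (ℤ → K)) [IsProbabilityMeasure μ] (hμ : IsStationaryLaw μ) :
    (StandardBorelSpace K ∨ IsLocallyCompactBaireSpace K →
      List.TFAE [IsExchangeableLaw μ, IsQuasiExchangeableUILaw μ, IsBernoulliMixture μ]) ∧
    (IsExchangeableLaw μ ↔ IsQuasiExchangeableUILaw μ) ∧
    (IsBernoulliMixture μ → IsExchangeableLaw μ) := by
  have h12 : IsExchangeableLaw μ ↔ IsQuasiExchangeableUILaw μ :=
    ⟨fun h => h.isQuasiExchangeableUILaw, fun h => h.isExchangeableLaw hμ⟩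
  have h31 : IsBernoulliMixture μ → IsExchangeableLaw μ := fun h => h.isExchangeableLaw
  refine ⟨fun hK => ?_, h12, h31⟩
  have h13 : IsExchangeableLaw μ → IsBernoulliMixture μ := by
    rcases hK with hK | ⟨t, hT2, hLC, hm⟩
    · exact fun h => h.isBernoulliMixture_of_standardBorelSpace hμ
    · exact fun h => h.isBernoulliMixture_of_baire hm hμ
  tfae_have 1 ↔ 2 := h12
  tfae_have 1 → 3 := h13
  tfae_have 3 → 1 := h31
  tfae_finish
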